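/- **Setting.** A block consists of $n\ge 0$ deterministic transactions $tx_0,\dots,tx_{n-1}$; a running transaction repeatedly reads a location, writes a value to a location, or halts, as determined by its code and by the values that it has read. A *version* is a pair $(j,i)$ of a transaction index and an incarnation number. Finitely many threads each invoke `run()` of the Block-STM algorithm below. A *run* is an interleaving (a global order) of their atomic operations, and a *time* is a point in this order. The read-only map `storage` gives the values of the locations before the block. **Shared variables** (initial values in parentheses). Multi-version memory: a map `data` from pairs (location, transaction index) to entries, which are either a pair (incarnation, value) or the marker ESTIMATE (empty); for each $j$, `last_written[j]`, a set of locations ($\emptyset$), and `last_read_set[j]`, a set of pairs (location, version or $\bot$) ($\emptyset$). Scheduler: `execution_idx`, `validation_idx`, `decrease_cnt`, `num_active_tasks` ($0$), `done_marker` (false); for each $j$, a set `txn_dependency[j]` of transaction indices ($\emptyset$) and a pair `txn_status[j]` (incarnation number, status) ($(0,\mathrm{READY})$), each protected by its own mutex, where the status is READY, EXECUTING, EXECUTED or ABORTING. Every access to a shared variable is atomic; the operands of a comparison are read separately, from left to right; conjunctions are evaluated from left to right. `read`$(\ell,j)$ (atomic): among the entries of `data` at $(\ell,j')$ with $j'<j$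 take the one with the largest $j'$. If there is none, return NOT_FOUND; if it is ESTIMATE, return READ_ERROR with blocking index $j'$; if it is $(i',a)$, return OK with version $(j',i')$ and value $a$. **Algorithm.** - `run()`: `task` $:=\bot$. While `done_marker` is observed to be false: if `task` is an execution task, set `task := try_execute(task.version)`; then, if `task` is a validation task, set `task := needs_reexecution(task.version)`; then, if `task` is $\bot$, set `task := next_task()`. When `done_marker` is observed to be true, return. - `try_execute(j,i)`: run $tx_j$ with an initially empty read-set $R$ and write-set $W$. A write of $a$ to $\ell$ replaces the entry for $\ell$ in $W$ by $(\ell,a)$. A read of $\ell$ yields the value in $W$ if there is one. Otherwise call `read`$(\ell,j)$: on NOT_FOUND use `storage`$(\ell)$ and add $(\ell,\bot)$ to $R$; on OK use the value and add $(\ell,\text{version})$ to $R$; on READ_ERROR with blocking index $b$ stop the execution, call `add_dependency(j,b)`, and if it returns false start `try_execute(j,i)` again, otherwise return $\bot$. When the transaction halts: set `data[(l,j)]` $:=(i,a)$ for every $(\ell,a)\in W$; load `prev := last_written[j]`; remove `data[(l,j)]` for every $\ell\in$ `prev` that is not a location of $W$; set `last_written[j]` to the set of locations of $W$; let `new` be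 true if and only if $W$ has a location outside `prev`; set `last_read_set[j]` $:=R$; return `finish_execution(j,i,new)`. - `add_dependency(j,b)`: holding the lock of `txn_dependency[b]`: if the status of $tx_b$ is EXECUTED, return false; otherwise set the status of $tx_j$ to ABORTING and insert $j$ into `txn_dependency[b]`. After releasing the lock, decrement `num_active_tasks` and return true. - `finish_execution(j,i,new)`: set the status of $tx_j$ to EXECUTED; with the lock of `txn_dependency[j]`, swap `txn_dependency[j]` with $\emptyset$, obtaining a set $D$; for each $d\in D$, call `set_ready(d)`; if $D\ne\emptyset$, set `execution_idx := min(execution_idx, min D)` atomically and then increment `decrease_cnt`. Then, if `validation_idx` $>j$: if `new`, set `validation_idx := min(validation_idx, j)` atomically and then increment `decrease_cnt`; if not `new`, return the validation task $(j,i)$. Unless this task was returned, decrement `num_active_tasks` and return $\bot$. - `set_ready(j)`: atomically replace `txn_status[j]` $=(i,\cdot)$ by $(i+1,\mathrm{READY})$. - `try_incarnate(k)`: if $k<n$ and `txn_status[k]` $=(i,\mathrm{READY})$, atomically set it to $(i,\mathrm{EXECUTING})$ and return the version $(k,i)$; otherwise return $\bot$. - `needs_reexecution(j,i)`: load `last_read_set[j]`;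 for each of its elements $(\ell,\nu)$, in any order, call `read`$(\ell,j)$, which agrees with $\nu$ if it returns NOT_FOUND and $\nu=\bot$, or OK with version $\nu$; stop at the first disagreement. If all agree, then `aborted` is false. If one disagrees and `txn_status[j]` $=(i,\mathrm{EXECUTED})$, atomically set it to $(i,\mathrm{ABORTING})$, and `aborted` is true; otherwise `aborted` is false. If `aborted`: load `last_written[j]` and set `data[(l,j)]` to ESTIMATE for each $\ell$ in it; call `set_ready(j)`; set `validation_idx := min(validation_idx, j+1)` atomically and then increment `decrease_cnt`; if `execution_idx` $>j$, call `try_incarnate(j)`, and if this returns a version, return the execution task with this version. If no task was returned, decrement `num_active_tasks` once and return $\bot$. - `next_task()`: if `validation_idx` $<$ `execution_idx`, return the validation task with the version given by `next_version_to_validate()`, else the execution task with the version given by `next_version_to_execute()` ($\bot$ if that is $\bot$). - `next_version_to_validate()`: if `validation_idx` $\ge n$, call `check_done()` and return $\bot$. Otherwise increment `num_active_tasks`, fetch-and-increment `validation_idx`, obtaining $k$; if $k<n$ and `txn_status[k]` $=(i,\mathrm{EXECUTED})$, return $(k,i)$; otherwise decrement `num_active_tasks` and return $\bot$. - `next_version_to_execute()`: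 if `execution_idx` $\ge n$, call `check_done()` and return $\bot$. Otherwise increment `num_active_tasks`, fetch-and-increment `execution_idx`, obtaining $k$, and call `try_incarnate(k)`; if it returns a version, return it; otherwise decrement `num_active_tasks` and return $\bot$. - `check_done()`: read `decrease_cnt`, obtaining $c$; if $\min(\texttt{execution\_idx},\texttt{validation\_idx})\ge n$, and `num_active_tasks` $=0$, and `decrease_cnt` $=c$ (read one after the other in this order), set `done_marker` to true. **Global commit.** A *pre-validation* of index $k$ is ongoing from the fetch-and-increment of `validation_idx` that returns $k$ until the matching decrement of `num_active_tasks` or the return of a validation task. An *execution* of a version of $tx_j$ is ongoing from the setting of the status to EXECUTING until the status is set to ABORTING in `add_dependency`, or `finish_execution` decrements `num_active_tasks`, or it returns a validation task. A *validation* of a version of $tx_j$ is ongoing from the moment when the validation task is returned to a thread until `needs_reexecution` decrements `num_active_tasks` or returns an execution task. The *global commit index* at time $T$ is the minimum of: `validation_idx`; all $j<n$ such that the status of $tx_j$ is not EXECUTED; all indices with an ongoing pre-validation; all transaction indices of versions with an ongoing execution or validation (all at time $T$). Transactions $tx_0,\dots,tx_k$ are *globally committed* at time $T$ if the global commit index at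 time $T$ is strictly greater than $k$. **Theorem.** In every run, at every time at which some thread has returned from `run()` (in particular, at the time at which it returns, having observed `done_marker` $=$ true), all transactions $tx_0,\dots,tx_{n-1}$ of the block are globally committed. -/

import Mathlib

namespace BlockSTM

universe u v w x

/-! ### Data -/

/-- Status of the current incarnation of a transaction. -/
inductive Status
  | readyToExecute
  | executing
  | executed
  | aborting

/-- A version: a transaction index together with an incarnation number. -/
structure Version (n : ℕ) where
  txn : Fin n
  incarnation : ℕ

/-- What a running transaction does next. -/
inductive Action (Loc : Type u) (Val : Type v) (σ : Type w)
  | read (l : Loc) (next : Val → σ)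
  | write (l : Loc) (a : Val) (next : σ)
  | halt

/-- A block of `n` deterministic transactions, given as programs with local states in `σ`. -/
structure Block (n : ℕ) (Loc : Type u) (Val : Type v) (σ : Type w) where
  start : Fin n → σ
  code : σ → Action Loc Val σ

/-- An entry of the multi-version map: a value with the incarnation that wrote it, or `ESTIMATE`. -/
inductive Entry (Val : Type v)
  | written (incarnation : ℕ) (a : Val)
  | estimate

/-- A task handed to a thread. -/
inductive Task (n : ℕ)
  | execution (v : Version n)
  | validation (v : Version n)

/-- The shared memory: the variables of the multi-version memory and of the scheduler.
`dependencyLock j` is the holder of the mutex that protects `txnDependency j`, if any. -/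
structure Shared (n : ℕ) (Loc : Type u) (Val : Type v) (Thread : Type x) where
  data : Loc → Fin n → Option (Entry Val)
  lastWrittenLocations : Fin n → Set Loc
  lastReadSet : Fin n → Set (Loc × Option (Version n))
  executionIdx : ℕ
  validationIdx : ℕ
  decreaseCnt : ℕ
  numActiveTasks : ℤ
  doneMarker : Bool
  txnDependency : Fin n → Set (Fin n)
  dependencyLock : Fin n → Option Thread
  txnStatus : Fin n → ℕ × Status

/-- The initial shared memory. -/
def Shared.init (n : ℕ) (Loc : Type u) (Val : Type v) (Thread : Type x) :
    Shared n Loc Val Thread where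
  data := fun _ _ => none
  lastWrittenLocations := fun _ => ∅
  lastReadSet := fun _ => ∅
  executionIdx := 0
  validationIdx := 0
  decreaseCnt := 0
  numActiveTasks := 0
  doneMarker := false
  txnDependency := fun _ => ∅
  dependencyLock := fun _ => none
  txnStatus := fun _ => (0, .readyToExecute)

open Classical in
/-- The multi-version map with the entry at `(l, j)` replaced. -/
noncomputable def setData {n : ℕ} {Loc : Type u} {Val : Type v}
    (d : Loc → Fin n → Option (Entry Val)) (l : Loc) (j : Fin n) (e : Option (Entry Val)) :
    Loc → Fin n → Option (Entry Val) :=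
  fun l' j' => if l' = l ∧ j' = j then e else d l' j'

/-- Result of a read from the multi-version memory. -/
inductive ReadResult (n : ℕ) (Val : Type v)
  | notFound
  | error (blocking : Fin n)
  | ok (version : Version n) (a : Val)

/-- `MVRead d l j r`: reading location `l` on behalf of transaction `j` returns `r`. The entry at
`l` with the highest transaction index below `j` decides. -/
inductive MVRead {n : ℕ} {Loc : Type u} {Val : Type v} (d : Loc → Fin n → Option (Entry Val))
    (l : Loc) (j : Fin n) : ReadResult n Val → Prop
  | notFound (h : ∀ i, i < j → d l i = none) : MVRead d l j .notFound
  | error (i : Fin n) (hij : i < j) (hi : d l i = some .estimate)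
      (h : ∀ i', i < i' → i' < j → d l i' = none) : MVRead d l j (.error i)
  | ok (i : Fin n) (inc : ℕ) (a : Val) (hij : i < j) (hi : d l i = some (.written inc a))
      (h : ∀ i', i < i' → i' < j → d l i' = none) : MVRead d l j (.ok ⟨i, inc⟩ a)

/-- A re-read agrees with the version recorded in the read-set (`none` means that the value came
from storage). -/
def ReadResult.Agrees {n : ℕ} {Val : Type v} : ReadResult n Val → Option (Version n) → Prop
  | .notFound, none => True
  | .ok version _, some version' => version = version'
  | _, _ => False

/-- Control states of a thread, with its local variables. Each one names the next atomic
operation. `v` is always the version of the task being processed. -/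
inductive PC (n : ℕ) (Loc : Type u) (Val : Type v) (σ : Type w)
  -- run
  | loopHead (task : Option (Task n))
  | returned (task : Option (Task n))
  -- try_execute: VM.execute
  | vmRun (v : Version n) (st : σ) (readSet : Set (Loc × Option (Version n)))
      (writeSet : Set (Loc × Val))
  -- add_dependency
  | depLock (v : Version n) (blocking : Fin n)
  | depCheck (v : Version n) (blocking : Fin n)
  | depRetry (v : Version n) (blocking : Fin n)
  | depAbort (v : Version n) (blocking : Fin n)
  | depInsert (v : Version n) (blocking : Fin n)
  | depUnlock (v : Version n) (blocking : Fin n)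
  | depDecrement (v : Version n)
  -- MVMemory.record
  | recApply (v : Version n) (readSet : Set (Loc × Option (Version n)))
      (writeSet : Set (Loc × Val)) (todo : Set (Loc × Val))
  | recLoad (v : Version n) (readSet : Set (Loc × Option (Version n))) (new : Set Loc)
  | recRemove (v : Version n) (readSet : Set (Loc × Option (Version n))) (new prev todo : Set Loc)
  | recStoreReads (v : Version n) (readSet : Set (Loc × Option (Version n))) (wroteNew : Prop)
  -- finish_execution
  | finSetExecuted (v : Version n) (wroteNew : Prop)
  | finSwapDeps (v : Version n) (wroteNew : Prop)
  | finResume (v : Version n) (wroteNew : Prop) (deps todo : Set (Fin n))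
  | finDecreaseEx (v : Version n) (wroteNew : Prop) (target : ℕ)
  | finDecreaseExCnt (v : Version n) (wroteNew : Prop)
  | finCheckVal (v : Version n) (wroteNew : Prop)
  | finDecreaseVal (v : Version n)
  | finDecreaseValCnt (v : Version n)
  | finDecrement (v : Version n)
  -- needs_reexecution: validate_read_set, try_validation_abort, convert_writes_to_estimates
  | valLoad (v : Version n)
  | valCheck (v : Version n) (todo : Set (Loc × Option (Version n)))
  | valTryAbort (v : Version n)
  | valEstLoad (v : Version n)
  | valEstMark (v : Version n) (todo : Set Loc)
  -- finish_validation
  | valSetReady (v : Version n)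
  | valDecreaseVal (v : Version n)
  | valDecreaseValCnt (v : Version n)
  | valCheckEx (v : Version n)
  | valIncarnate (v : Version n)
  | valDecrement (v : Version n)
  -- next_task
  | ntReadVal
  | ntReadEx (validationIdx : ℕ)
  -- next_version_to_validate
  | nvCheck
  | nvIncrement
  | nvFetch
  | nvStatus (idx : ℕ)
  | nvDecrement (idx : ℕ)
  -- next_version_to_execute
  | neCheck
  | neIncrement
  | neFetch
  | neIncarnate (idx : ℕ)
  | neDecrement (idx : ℕ)
  -- check_done
  | cdCnt
  | cdEx (observedCnt : ℕ)
  | cdVal (observedCnt executionIdx : ℕ)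
  | cdActive (observedCnt : ℕ)
  | cdCntAgain (observedCnt : ℕ)
  | cdSet

/-! ### The algorithm -/

/-- `LStep B storage t s p s' p'`: thread `t` at control state `p` performs one atomic operation,
changing the shared memory from `s` to `s'`, and arrives at `p'`. Every critical section of a
mutex protecting an entry of `txnStatus` accesses only that entry and is one atomic operation. -/
inductive LStep {n : ℕ} {Loc : Type u} {Val : Type v} {σ : Type w} {Thread : Type x}
    (B : Block n Loc Val σ) (storage : Loc → Val) (t : Thread) (s : Shared n Loc Val Thread) :
    PC n Loc Val σ → Shared n Loc Val Thread → PC n Loc Val σ → Prop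
  -- run: `while ¬ done()`
  | loop_exit (task) (h : s.doneMarker = true) : LStep B storage t s (.loopHead task) s (.returned task)
  | loop_execute (v) (h : s.doneMarker = false) :
      LStep B storage t s (.loopHead (some (.execution v))) s (.vmRun v (B.start v.txn) ∅ ∅)
  | loop_validate (v) (h : s.doneMarker = false) :
      LStep B storage t s (.loopHead (some (.validation v))) s (.valLoad v)
  | loop_next (h : s.doneMarker = false) : LStep B storage t s (.loopHead none) s .ntReadVal
  -- VM.execute
  | vm_write (v st rs ws l a st') (h : B.code st = .write l a st') :
      LStep B storage t s (.vmRun v st rs ws) s (.vmRun v st' rs ({q ∈ ws | q.1 ≠ l} ∪ {(l, a)}))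
  | vm_read_own (v st rs ws l k a) (h : B.code st = .read l k) (hl : (l, a) ∈ ws) :
      LStep B storage t s (.vmRun v st rs ws) s (.vmRun v (k a) rs ws)
  | vm_read_storage (v st rs ws l k) (h : B.code st = .read l k) (hl : ∀ a, (l, a) ∉ ws)
      (hr : MVRead s.data l v.txn .notFound) :
      LStep B storage t s (.vmRun v st rs ws) s (.vmRun v (k (storage l)) (rs ∪ {(l, none)}) ws)
  | vm_read_ok (v st rs ws l k ver a) (h : B.code st = .read l k) (hl : ∀ a, (l, a) ∉ ws)
      (hr : MVRead s.data l v.txn (.ok ver a)) :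
      LStep B storage t s (.vmRun v st rs ws) s (.vmRun v (k a) (rs ∪ {(l, some ver)}) ws)
  | vm_read_error (v st rs ws l k b) (h : B.code st = .read l k) (hl : ∀ a, (l, a) ∉ ws)
      (hr : MVRead s.data l v.txn (.error b)) :
      LStep B storage t s (.vmRun v st rs ws) s (.depLock v b)
  | vm_halt (v st rs ws) (h : B.code st = .halt) :
      LStep B storage t s (.vmRun v st rs ws) s (.recApply v rs ws ws)
  -- add_dependency
  | dep_lock (v b) (h : s.dependencyLock b = none) :
      LStep B storage t s (.depLock v b)
        { s with dependencyLock := Function.update s.dependencyLock b (some t) } (.depCheck v b)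
  | dep_check_executed (v b) (h : (s.txnStatus b).2 = .executed) :
      LStep B storage t s (.depCheck v b) s (.depRetry v b)
  | dep_check_other (v b) (h : (s.txnStatus b).2 ≠ .executed) :
      LStep B storage t s (.depCheck v b) s (.depAbort v b)
  | dep_retry (v b) :
      LStep B storage t s (.depRetry v b)
        { s with dependencyLock := Function.update s.dependencyLock b none }
        (.vmRun v (B.start v.txn) ∅ ∅)
  | dep_abort (v b) :
      LStep B storage t s (.depAbort v b)
        { s with txnStatus := Function.update s.txnStatus v.txn
                  ((s.txnStatus v.txn).1, .aborting) } (.depInsert v b)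
  | dep_insert (v b) :
      LStep B storage t s (.depInsert v b)
        { s with txnDependency := Function.update s.txnDependency b
                  (s.txnDependency b ∪ {v.txn}) } (.depUnlock v b)
  | dep_unlock (v b) :
      LStep B storage t s (.depUnlock v b)
        { s with dependencyLock := Function.update s.dependencyLock b none } (.depDecrement v)
  | dep_decrement (v) :
      LStep B storage t s (.depDecrement v)
        { s with numActiveTasks := s.numActiveTasks - 1 } .ntReadVal
  -- MVMemory.record
  | rec_apply (v rs ws todo l a) (h : (l, a) ∈ todo) :
      LStep B storage t s (.recApply v rs ws todo)
        { s with data := setData s.data l v.txn (some (.written v.incarnation a)) }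
        (.recApply v rs ws (todo \ {(l, a)}))
  | rec_apply_end (v rs ws) :
      LStep B storage t s (.recApply v rs ws ∅) s (.recLoad v rs (Prod.fst '' ws))
  | rec_load (v rs new) :
      LStep B storage t s (.recLoad v rs new) s
        (.recRemove v rs new (s.lastWrittenLocations v.txn) (s.lastWrittenLocations v.txn \ new))
  | rec_remove (v rs new prev todo l) (h : l ∈ todo) :
      LStep B storage t s (.recRemove v rs new prev todo)
        { s with data := setData s.data l v.txn none } (.recRemove v rs new prev (todo \ {l}))
  | rec_store_written (v rs new prev) :
      LStep B storage t s (.recRemove v rs new prev ∅)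
        { s with lastWrittenLocations := Function.update s.lastWrittenLocations v.txn new }
        (.recStoreReads v rs (new \ prev ≠ ∅))
  | rec_store_reads (v rs wroteNew) :
      LStep B storage t s (.recStoreReads v rs wroteNew)
        { s with lastReadSet := Function.update s.lastReadSet v.txn rs }
        (.finSetExecuted v wroteNew)
  -- finish_execution
  | fin_set_executed (v wroteNew) :
      LStep B storage t s (.finSetExecuted v wroteNew)
        { s with txnStatus := Function.update s.txnStatus v.txn
                  ((s.txnStatus v.txn).1, .executed) } (.finSwapDeps v wroteNew)
  | fin_swap_deps (v wroteNew) (h : s.dependencyLock v.txn = none) :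
      LStep B storage t s (.finSwapDeps v wroteNew)
        { s with txnDependency := Function.update s.txnDependency v.txn ∅ }
        (.finResume v wroteNew (s.txnDependency v.txn) (s.txnDependency v.txn))
  | fin_resume (v wroteNew deps todo d) (h : d ∈ todo) :
      LStep B storage t s (.finResume v wroteNew deps todo)
        { s with txnStatus := Function.update s.txnStatus d
                  ((s.txnStatus d).1 + 1, .readyToExecute) }
        (.finResume v wroteNew deps (todo \ {d}))
  | fin_resume_none (v wroteNew deps) (h : deps = ∅) :
      LStep B storage t s (.finResume v wroteNew deps ∅) s (.finCheckVal v wroteNew)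
  | fin_resume_some (v wroteNew deps m) (h : IsLeast deps m) :
      LStep B storage t s (.finResume v wroteNew deps ∅) s (.finDecreaseEx v wroteNew m)
  | fin_decrease_ex (v wroteNew target) :
      LStep B storage t s (.finDecreaseEx v wroteNew target)
        { s with executionIdx := min s.executionIdx target } (.finDecreaseExCnt v wroteNew)
  | fin_decrease_ex_cnt (v wroteNew) :
      LStep B storage t s (.finDecreaseExCnt v wroteNew)
        { s with decreaseCnt := s.decreaseCnt + 1 } (.finCheckVal v wroteNew)
  | fin_check_new (v) (wroteNew : Prop) (h : (v.txn : ℕ) < s.validationIdx) (hw : wroteNew) :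
      LStep B storage t s (.finCheckVal v wroteNew) s (.finDecreaseVal v)
  | fin_check_validate (v) (wroteNew : Prop) (h : (v.txn : ℕ) < s.validationIdx)
      (hw : ¬ wroteNew) : LStep B storage t s (.finCheckVal v wroteNew) s (.valLoad v)
  | fin_check_low (v wroteNew) (h : s.validationIdx ≤ (v.txn : ℕ)) :
      LStep B storage t s (.finCheckVal v wroteNew) s (.finDecrement v)
  | fin_decrease_val (v) :
      LStep B storage t s (.finDecreaseVal v)
        { s with validationIdx := min s.validationIdx v.txn } (.finDecreaseValCnt v)
  | fin_decrease_val_cnt (v) :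
      LStep B storage t s (.finDecreaseValCnt v)
        { s with decreaseCnt := s.decreaseCnt + 1 } (.finDecrement v)
  | fin_decrement (v) :
      LStep B storage t s (.finDecrement v)
        { s with numActiveTasks := s.numActiveTasks - 1 } .ntReadVal
  -- needs_reexecution
  | val_load (v) : LStep B storage t s (.valLoad v) s (.valCheck v (s.lastReadSet v.txn))
  | val_check_agree (v todo l ver r) (h : (l, ver) ∈ todo) (hr : MVRead s.data l v.txn r)
      (ha : r.Agrees ver) :
      LStep B storage t s (.valCheck v todo) s (.valCheck v (todo \ {(l, ver)}))
  | val_check_fail (v todo l ver r) (h : (l, ver) ∈ todo) (hr : MVRead s.data l v.txn r)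
      (ha : ¬ r.Agrees ver) : LStep B storage t s (.valCheck v todo) s (.valTryAbort v)
  | val_check_end (v) : LStep B storage t s (.valCheck v ∅) s (.valDecrement v)
  | val_abort (v) (h : s.txnStatus v.txn = (v.incarnation, .executed)) :
      LStep B storage t s (.valTryAbort v)
        { s with txnStatus := Function.update s.txnStatus v.txn (v.incarnation, .aborting) }
        (.valEstLoad v)
  | val_abort_fail (v) (h : s.txnStatus v.txn ≠ (v.incarnation, .executed)) :
      LStep B storage t s (.valTryAbort v) s (.valDecrement v)
  | val_est_load (v) :
      LStep B storage t s (.valEstLoad v) s (.valEstMark v (s.lastWrittenLocations v.txn))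
  | val_est_mark (v todo l) (h : l ∈ todo) :
      LStep B storage t s (.valEstMark v todo)
        { s with data := setData s.data l v.txn (some .estimate) } (.valEstMark v (todo \ {l}))
  | val_est_end (v) : LStep B storage t s (.valEstMark v ∅) s (.valSetReady v)
  -- finish_validation
  | val_set_ready (v) :
      LStep B storage t s (.valSetReady v)
        { s with txnStatus := Function.update s.txnStatus v.txn
                  ((s.txnStatus v.txn).1 + 1, .readyToExecute) } (.valDecreaseVal v)
  | val_decrease_val (v) :
      LStep B storage t s (.valDecreaseVal v)
        { s with validationIdx := min s.validationIdx ((v.txn : ℕ) + 1) } (.valDecreaseValCnt v)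
  | val_decrease_val_cnt (v) :
      LStep B storage t s (.valDecreaseValCnt v)
        { s with decreaseCnt := s.decreaseCnt + 1 } (.valCheckEx v)
  | val_check_ex_high (v) (h : (v.txn : ℕ) < s.executionIdx) :
      LStep B storage t s (.valCheckEx v) s (.valIncarnate v)
  | val_check_ex_low (v) (h : s.executionIdx ≤ (v.txn : ℕ)) :
      LStep B storage t s (.valCheckEx v) s (.valDecrement v)
  | val_incarnate (v) (h : (s.txnStatus v.txn).2 = .readyToExecute) :
      LStep B storage t s (.valIncarnate v)
        { s with txnStatus := Function.update s.txnStatus v.txn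
                  ((s.txnStatus v.txn).1, .executing) }
        (.loopHead (some (.execution ⟨v.txn, (s.txnStatus v.txn).1⟩)))
  | val_incarnate_fail (v) (h : (s.txnStatus v.txn).2 ≠ .readyToExecute) :
      LStep B storage t s (.valIncarnate v) s (.valDecrement v)
  | val_decrement (v) :
      LStep B storage t s (.valDecrement v)
        { s with numActiveTasks := s.numActiveTasks - 1 } .ntReadVal
  -- next_task
  | nt_read_val : LStep B storage t s .ntReadVal s (.ntReadEx s.validationIdx)
  | nt_validate (i) (h : i < s.executionIdx) : LStep B storage t s (.ntReadEx i) s .nvCheck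
  | nt_execute (i) (h : s.executionIdx ≤ i) : LStep B storage t s (.ntReadEx i) s .neCheck
  -- next_version_to_validate
  | nv_check_done (h : n ≤ s.validationIdx) : LStep B storage t s .nvCheck s .cdCnt
  | nv_check (h : s.validationIdx < n) : LStep B storage t s .nvCheck s .nvIncrement
  | nv_increment :
      LStep B storage t s .nvIncrement { s with numActiveTasks := s.numActiveTasks + 1 } .nvFetch
  | nv_fetch :
      LStep B storage t s .nvFetch { s with validationIdx := s.validationIdx + 1 }
        (.nvStatus s.validationIdx)
  | nv_status_executed (j : Fin n) (h : (s.txnStatus j).2 = .executed) :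
      LStep B storage t s (.nvStatus j) s
        (.loopHead (some (.validation ⟨j, (s.txnStatus j).1⟩)))
  | nv_status_other (j : Fin n) (h : (s.txnStatus j).2 ≠ .executed) :
      LStep B storage t s (.nvStatus j) s (.nvDecrement j)
  | nv_status_out (idx) (h : n ≤ idx) : LStep B storage t s (.nvStatus idx) s (.nvDecrement idx)
  | nv_decrement (idx) :
      LStep B storage t s (.nvDecrement idx)
        { s with numActiveTasks := s.numActiveTasks - 1 } (.loopHead none)
  -- next_version_to_execute
  | ne_check_done (h : n ≤ s.executionIdx) : LStep B storage t s .neCheck s .cdCnt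
  | ne_check (h : s.executionIdx < n) : LStep B storage t s .neCheck s .neIncrement
  | ne_increment :
      LStep B storage t s .neIncrement { s with numActiveTasks := s.numActiveTasks + 1 } .neFetch
  | ne_fetch :
      LStep B storage t s .neFetch { s with executionIdx := s.executionIdx + 1 }
        (.neIncarnate s.executionIdx)
  | ne_incarnate (j : Fin n) (h : (s.txnStatus j).2 = .readyToExecute) :
      LStep B storage t s (.neIncarnate j)
        { s with txnStatus := Function.update s.txnStatus j ((s.txnStatus j).1, .executing) }
        (.loopHead (some (.execution ⟨j, (s.txnStatus j).1⟩)))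
  | ne_incarnate_fail (j : Fin n) (h : (s.txnStatus j).2 ≠ .readyToExecute) :
      LStep B storage t s (.neIncarnate j) s (.neDecrement j)
  | ne_incarnate_out (idx) (h : n ≤ idx) :
      LStep B storage t s (.neIncarnate idx) s (.neDecrement idx)
  | ne_decrement (idx) :
      LStep B storage t s (.neDecrement idx)
        { s with numActiveTasks := s.numActiveTasks - 1 } (.loopHead none)
  -- check_done
  | cd_cnt : LStep B storage t s .cdCnt s (.cdEx s.decreaseCnt)
  | cd_ex (c) : LStep B storage t s (.cdEx c) s (.cdVal c s.executionIdx)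
  | cd_val (c e) (h : n ≤ min e s.validationIdx) : LStep B storage t s (.cdVal c e) s (.cdActive c)
  | cd_val_fail (c e) (h : min e s.validationIdx < n) :
      LStep B storage t s (.cdVal c e) s (.loopHead none)
  | cd_active (c) (h : s.numActiveTasks = 0) : LStep B storage t s (.cdActive c) s (.cdCntAgain c)
  | cd_active_fail (c) (h : s.numActiveTasks ≠ 0) :
      LStep B storage t s (.cdActive c) s (.loopHead none)
  | cd_cnt_again (c) (h : c = s.decreaseCnt) : LStep B storage t s (.cdCntAgain c) s .cdSet
  | cd_cnt_again_fail (c) (h : c ≠ s.decreaseCnt) :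
      LStep B storage t s (.cdCntAgain c) s (.loopHead none)
  | cd_set : LStep B storage t s .cdSet { s with doneMarker := true } (.loopHead none)

/-- A configuration: the shared memory and the control state of each thread. -/
structure Config (n : ℕ) (Loc : Type u) (Val : Type v) (σ : Type w) (Thread : Type x) where
  shared : Shared n Loc Val Thread
  pc : Thread → PC n Loc Val σ

/-- Every thread has invoked `run`. -/
def Config.init (n : ℕ) (Loc : Type u) (Val : Type v) (σ : Type w) (Thread : Type x) :
    Config n Loc Val σ Thread where
  shared := Shared.init n Loc Val Thread
  pc := fun _ => .loopHead none

/-- Some thread performs one atomic operation. -/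
def Step {n : ℕ} {Loc : Type u} {Val : Type v} {σ : Type w} {Thread : Type x} [DecidableEq Thread]
    (B : Block n Loc Val σ) (storage : Loc → Val) (c c' : Config n Loc Val σ Thread) : Prop :=
  ∃ (t : Thread) (p' : PC n Loc Val σ),
    LStep B storage t c.shared (c.pc t) c'.shared p' ∧ c'.pc = Function.update c.pc t p'

/-- `c` occurs at some time of some concurrent run of the algorithm. -/
def Reachable {n : ℕ} {Loc : Type u} {Val : Type v} {σ : Type w} {Thread : Type x}
    [DecidableEq Thread] (B : Block n Loc Val σ) (storage : Loc → Val)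
    (c : Config n Loc Val σ Thread) : Prop :=
  Relation.ReflTransGen (Step B storage) (Config.init n Loc Val σ Thread) c

/-! ### The commit rule -/

/-- A thread at this control state has an ongoing pre-validation of index `j`: the
fetch-and-increment that returned `j` was performed, and neither the matching decrement was
performed nor a validation task returned. -/
def PC.PreValidates {n : ℕ} {Loc : Type u} {Val : Type v} {σ : Type w} :
    PC n Loc Val σ → ℕ → Prop
  | .nvStatus idx, j => idx = j
  | .nvDecrement idx, j => idx = j
  | _, _ => False

/-- A thread at this control state has an ongoing execution of a version of transaction `j`: from
the moment when it set the status to `EXECUTING` until it sets the status to `ABORTING` because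
of a dependency, or decrements the number of active tasks, or obtains a validation task. -/
def PC.Executes {n : ℕ} {Loc : Type u} {Val : Type v} {σ : Type w} :
    PC n Loc Val σ → ℕ → Prop
  | .loopHead (some (.execution v)), j => (v.txn : ℕ) = j
  | .returned (some (.execution v)), j => (v.txn : ℕ) = j
  | .vmRun v _ _ _, j => (v.txn : ℕ) = j
  | .depLock v _, j => (v.txn : ℕ) = j
  | .depCheck v _, j => (v.txn : ℕ) = j
  | .depRetry v _, j => (v.txn : ℕ) = j
  | .depAbort v _, j => (v.txn : ℕ) = j
  | .recApply v _ _ _, j => (v.txn : ℕ) = j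
  | .recLoad v _ _, j => (v.txn : ℕ) = j
  | .recRemove v _ _ _ _, j => (v.txn : ℕ) = j
  | .recStoreReads v _ _, j => (v.txn : ℕ) = j
  | .finSetExecuted v _, j => (v.txn : ℕ) = j
  | .finSwapDeps v _, j => (v.txn : ℕ) = j
  | .finResume v _ _ _, j => (v.txn : ℕ) = j
  | .finDecreaseEx v _ _, j => (v.txn : ℕ) = j
  | .finDecreaseExCnt v _, j => (v.txn : ℕ) = j
  | .finCheckVal v _, j => (v.txn : ℕ) = j
  | .finDecreaseVal v, j => (v.txn : ℕ) = j
  | .finDecreaseValCnt v, j => (v.txn : ℕ) = j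
  | .finDecrement v, j => (v.txn : ℕ) = j
  | _, _ => False

/-- A thread at this control state has an ongoing validation of a version of transaction `j`: from
the moment when the validation task was returned to it until it decrements the number of active
tasks or obtains an execution task. -/
def PC.Validates {n : ℕ} {Loc : Type u} {Val : Type v} {σ : Type w} :
    PC n Loc Val σ → ℕ → Prop
  | .loopHead (some (.validation v)), j => (v.txn : ℕ) = j
  | .returned (some (.validation v)), j => (v.txn : ℕ) = j
  | .valLoad v, j => (v.txn : ℕ) = j
  | .valCheck v _, j => (v.txn : ℕ) = j
  | .valTryAbort v, j => (v.txn : ℕ) = j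
  | .valEstLoad v, j => (v.txn : ℕ) = j
  | .valEstMark v _, j => (v.txn : ℕ) = j
  | .valSetReady v, j => (v.txn : ℕ) = j
  | .valDecreaseVal v, j => (v.txn : ℕ) = j
  | .valDecreaseValCnt v, j => (v.txn : ℕ) = j
  | .valCheckEx v, j => (v.txn : ℕ) = j
  | .valIncarnate v, j => (v.txn : ℕ) = j
  | .valDecrement v, j => (v.txn : ℕ) = j
  | _, _ => False

/-- The global commit index (the set is nonempty, so the infimum is its minimum). -/
noncomputable def Config.globalCommitIndex {n : ℕ} {Loc : Type u} {Val : Type v} {σ : Type w}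
    {Thread : Type x} (c : Config n Loc Val σ Thread) : ℕ :=
  sInf ({c.shared.validationIdx}
    ∪ {j | ∃ i : Fin n, (i : ℕ) = j ∧ (c.shared.txnStatus i).2 ≠ .executed}
    ∪ {j | ∃ t, (c.pc t).PreValidates j}
    ∪ {j | ∃ t, (c.pc t).Executes j ∨ (c.pc t).Validates j})

/-- Transactions `0, …, k` are globally committed. -/
def Config.GloballyCommitted {n : ℕ} {Loc : Type u} {Val : Type v} {σ : Type w}
    {Thread : Type x} (c : Config n Loc Val σ Thread) (k : Fin n) : Prop :=
  (k : ℕ) < c.globalCommitIndex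

end BlockSTM

/-!
A thread returns from `run` only after it has observed `doneMarker`, so it suffices that the
configuration is *quiescent* (`Config.Quiescent`) whenever `doneMarker` is set: all transactions are
executed, `executionIdx` and `validationIdx` are at least `n`, and no thread has a task or can
obtain one. Quiescence is stable under every atomic operation (`LStep.quiescent`), and it puts every
candidate for the global commit index at `n` or above (`Config.Quiescent.globallyCommitted`).

Quiescence begins when a thread in `check_done` reads `numActiveTasks = 0` and later finds
`decreaseCnt` unchanged.

* `numActiveTasks` is the number of threads between its increment and the matching decrement, so at
  that moment no thread has a task.
* Every decrease of `executionIdx` or `validationIdx` is counted in `decreaseCnt` by a thread that is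
  active in the meantime. As no thread is active and `decreaseCnt` is unchanged, neither counter
  was lowered since it was read; so both are at least `n`. The predicate `Config.CheckDone` records
  what the thread knows on its way through `check_done`, conditionally on `decreaseCnt` being
  unchanged.
* All transactions are executed (`Config.Invariant.quiescent`). For every transaction that is not
  executed, either it is ready and `executionIdx` has still to pass it, or it waits in some
  `txnDependency b`, or an active thread is in charge of it (`PC.InCharge`). With no active thread
  and `executionIdx` at least `n`, only waiting remains. A transaction waits only for a
  smaller one, and the mutex of `txnDependency b` ensures that a `b` with dependents has still to be
  executed or is about to be swapped by an active thread, so the least transaction that is not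
  executed cannot wait.

These facts make up `Config.Invariant`, which `LStep.invariant` carries through every operation. The
case distinctions over the operations concern one thread at a time and do not mention the other
threads; they are the lemmas on `LStep` in the part on the effect of one operation.
-/

namespace BlockSTM

universe u v w x

variable {n : ℕ} {Loc : Type u} {Val : Type v} {σ : Type w} {Thread : Type x}
  {B : Block n Loc Val σ} {storage : Loc → Val} {t : Thread} {s s' : Shared n Loc Val Thread}
  {p p' : PC n Loc Val σ}

/-! ### Control states -/

/-- The contribution of a thread at this control state to `numActiveTasks`: `1` from the increment
in `next_task` until the matching decrement, `0` otherwise. -/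
def PC.activity : PC n Loc Val σ → ℤ
  | .loopHead none => 0
  | .returned none => 0
  | .ntReadVal => 0
  | .ntReadEx _ => 0
  | .nvCheck => 0
  | .nvIncrement => 0
  | .neCheck => 0
  | .neIncrement => 0
  | .cdCnt => 0
  | .cdEx _ => 0
  | .cdVal _ _ => 0
  | .cdActive _ => 0
  | .cdCntAgain _ => 0
  | .cdSet => 0
  | _ => 1

/-- The control states from which a thread cannot obtain a task any more once all transactions are
executed and both counters are at least `n`: the inactive ones, those before a
fetch-and-increment, those that have fetched an index out of range, and the one that gives up an
execution. -/
def PC.Inert : PC n Loc Val σ → Prop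
  | .nvFetch => True
  | .nvStatus idx => n ≤ idx
  | .nvDecrement idx => n ≤ idx
  | .neFetch => True
  | .neIncarnate idx => n ≤ idx
  | .neDecrement _ => True
  | p => p.activity = 0

/-- The thread holds the mutex of `txnDependency b`. -/
def PC.Holds : PC n Loc Val σ → Fin n → Prop
  | .depCheck _ b', b => b' = b
  | .depRetry _ b', b => b' = b
  | .depAbort _ b', b => b' = b
  | .depInsert _ b', b => b' = b
  | .depUnlock _ b', b => b' = b
  | _, _ => False

/-- The thread has found, under the mutex of `txnDependency b`, that `b` is not executed, and has
not yet inserted its own transaction into `txnDependency b`. -/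
def PC.Registers : PC n Loc Val σ → Fin n → Prop
  | .depAbort _ b', b => b' = b
  | .depInsert _ b', b => b' = b
  | _, _ => False

/-- The thread has set the status of `b` to `EXECUTED` and is about to swap `txnDependency b`. -/
def PC.Swaps : PC n Loc Val σ → Fin n → Prop
  | .finSwapDeps v _, b => v.txn = b
  | _, _ => False

/-- Constraints on the local variables of a thread: a blocking transaction is below the blocked
one, and `finish_execution` resumes only dependencies that it obtained. -/
def PC.WellFormed : PC n Loc Val σ → Prop
  | .depLock v b => b < v.txn
  | .depCheck v b => b < v.txn
  | .depRetry v b => b < v.txn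
  | .depAbort v b => b < v.txn
  | .depInsert v b => b < v.txn
  | .finResume _ _ deps todo => todo ⊆ deps
  | _ => True

/-- The thread has lowered `executionIdx` and not yet counted this in `decreaseCnt`. -/
def PC.LoweredEx : PC n Loc Val σ → Prop
  | .finDecreaseExCnt _ _ => True
  | _ => False

/-- The thread has lowered `validationIdx` and not yet counted this in `decreaseCnt`. -/
def PC.LoweredVal : PC n Loc Val σ → Prop
  | .finDecreaseValCnt _ => True
  | .valDecreaseValCnt _ => True
  | _ => False

/-- The thread is in charge of the transaction `j` with the given unfinished status: it will
change this status, or make sure that `executionIdx` is at most `j` if `j` is ready. In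
`finResume`, the thread is in charge of the aborting transactions that it has still to resume, and
of all its dependencies that are ready, because it is about to lower `executionIdx` to the least
dependency. -/
def PC.InCharge : PC n Loc Val σ → Status → Fin n → Prop
  | .loopHead (some (.execution v)), st, j => st = .executing ∧ v.txn = j
  | .returned (some (.execution v)), st, j => st = .executing ∧ v.txn = j
  | .vmRun v _ _ _, st, j => st = .executing ∧ v.txn = j
  | .depLock v _, st, j => st = .executing ∧ v.txn = j
  | .depCheck v _, st, j => st = .executing ∧ v.txn = j
  | .depRetry v _, st, j => st = .executing ∧ v.txn = j
  | .depAbort v _, st, j => st = .executing ∧ v.txn = j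
  | .recApply v _ _ _, st, j => st = .executing ∧ v.txn = j
  | .recLoad v _ _, st, j => st = .executing ∧ v.txn = j
  | .recRemove v _ _ _ _, st, j => st = .executing ∧ v.txn = j
  | .recStoreReads v _ _, st, j => st = .executing ∧ v.txn = j
  | .finSetExecuted v _, st, j => st = .executing ∧ v.txn = j
  | .depInsert v _, st, j => st = .aborting ∧ v.txn = j
  | .finResume _ _ deps todo, st, j =>
    st = .aborting ∧ j ∈ todo ∨ st = .readyToExecute ∧ j ∈ deps
  | .valEstLoad v, st, j => st = .aborting ∧ v.txn = j
  | .valEstMark v _, st, j => st = .aborting ∧ v.txn = j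
  | .valSetReady v, st, j => st = .aborting ∧ v.txn = j
  | .finDecreaseEx _ _ target, st, j => st = .readyToExecute ∧ target ≤ j
  | .valDecreaseVal v, st, j => st = .readyToExecute ∧ v.txn = j
  | .valDecreaseValCnt v, st, j => st = .readyToExecute ∧ v.txn = j
  | .valCheckEx v, st, j => st = .readyToExecute ∧ v.txn = j
  | .valIncarnate v, st, j => st = .readyToExecute ∧ v.txn = j
  | .neIncarnate idx, st, j => st = .readyToExecute ∧ idx = j
  | _, _, _ => False

/-- No thread need be in charge of `j`: it is executed, or the counter `executionIdx` has still
to pass it, or it waits for another transaction. -/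
def Shared.Settled (s : Shared n Loc Val Thread) (j : Fin n) : Prop :=
  (s.txnStatus j).2 = .executed ∨
  (s.txnStatus j).2 = .readyToExecute ∧ s.executionIdx ≤ j ∨
  (s.txnStatus j).2 = .aborting ∧ ∃ b, j ∈ s.txnDependency b

theorem PC.activity_nonneg (p : PC n Loc Val σ) : 0 ≤ p.activity := by
  unfold PC.activity
  split <;> simp

theorem PC.not_inCharge (h : p.activity = 0) (st : Status) (j : Fin n) : ¬ p.InCharge st j := by
  unfold PC.activity at h
  split at h <;> simp_all [PC.InCharge]

theorem PC.not_lowered (h : p.activity = 0) : ¬ p.LoweredEx ∧ ¬ p.LoweredVal := by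
  unfold PC.activity at h
  split at h <;> simp_all [PC.LoweredEx, PC.LoweredVal]

theorem PC.not_swaps (h : p.activity = 0) (b : Fin n) : ¬ p.Swaps b := by
  unfold PC.activity at h
  split at h <;> simp_all [PC.Swaps]

theorem PC.inert_of_activity (h : p.activity = 0) : p.Inert := by
  unfold PC.activity at h
  split at h <;> simp_all [PC.Inert, PC.activity]

/-- An inert thread has no ongoing pre-validation, execution or validation of a transaction of the
block. -/
theorem PC.Inert.le {j : ℕ} (h : p.Inert)
    (hj : p.PreValidates j ∨ p.Executes j ∨ p.Validates j) : n ≤ j := by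
  unfold PC.Inert PC.activity at h
  grind [PC.PreValidates, PC.Executes, PC.Validates]

theorem PC.Registers.holds {b : Fin n} (h : p.Registers b) : p.Holds b := by
  cases p <;> simp_all [PC.Registers, PC.Holds]

/-! ### The effect of one atomic operation -/

theorem MVRead.lt_of_error {d : Loc → Fin n → Option (Entry Val)} {l : Loc} {j b : Fin n}
    (h : MVRead d l j (.error b)) : b < j := by
  cases h
  assumption

theorem LStep.numActiveTasks_eq (h : LStep B storage t s p s' p') :
    s'.numActiveTasks = s.numActiveTasks - p.activity + p'.activity := by
  cases h <;> simp [PC.activity]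
  all_goals grind

theorem LStep.wellFormed (h : LStep B storage t s p s' p') (hp : p.WellFormed) :
    p'.WellFormed := by
  cases h <;> simp_all [PC.WellFormed]
  all_goals grind [MVRead.lt_of_error]

theorem LStep.holds (h : LStep B storage t s p s' p')
    (hp : ∀ b, p.Holds b → s.dependencyLock b = some t) (b : Fin n) (hb : p'.Holds b) :
    s'.dependencyLock b = some t := by
  cases h <;> simp_all [PC.Holds]

theorem LStep.dependencyLock_eq_some (h : LStep B storage t s p s' p')
    (hp : ∀ b, p.Holds b → s.dependencyLock b = some t) {u : Thread} (hu : u ≠ t) (b : Fin n)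
    (hb : s.dependencyLock b = some u) : s'.dependencyLock b = some u := by
  cases h <;> simp_all [PC.Holds, Function.update_apply]
  all_goals grind

theorem LStep.lt_of_mem_txnDependency (h : LStep B storage t s p s' p') (hp : p.WellFormed)
    (hs : ∀ b j, j ∈ s.txnDependency b → b < j) (b j : Fin n) (hj : j ∈ s'.txnDependency b) :
    b < j := by
  cases h <;> simp_all [PC.WellFormed, Function.update_apply]
  all_goals grind

/-- A thread in charge of `j` stays in charge of it until `j` is settled. In particular
`depInsert` leaves `j` waiting for `b`, `finSwapDeps` takes over all who wait, and after
`finDecreaseEx` the counter `executionIdx` has still to pass every resumed transaction. -/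
theorem LStep.settled_or_inCharge (h : LStep B storage t s p s' p') (hp : p.WellFormed)
    (j : Fin n) (hj : s.Settled j ∨ p.InCharge (s.txnStatus j).2 j) :
    s'.Settled j ∨ p'.InCharge (s'.txnStatus j).2 j := by
  cases h
  case dep_insert v b =>
    have hdep : (∃ b, j ∈ s.txnDependency b) ∨ v.txn = j →
        ∃ b', j ∈ Function.update s.txnDependency b (s.txnDependency b ∪ {v.txn}) b' := by
      rintro (⟨b', hb'⟩ | rfl)
      · exact ⟨b', by by_cases h : b' = b <;> simp_all⟩
      · exact ⟨b, by simp⟩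
    simp only [Shared.Settled, PC.InCharge] at hj ⊢
    tauto
  case fin_resume_some v wroteNew deps m h =>
    simp only [Shared.Settled, PC.InCharge] at hj ⊢
    have hle : j ∈ deps → (m : ℕ) ≤ j := fun hj => h.2 hj
    simp at hj ⊢
    tauto
  all_goals simp_all [Shared.Settled, PC.WellFormed, PC.InCharge, Function.update_apply]
  all_goals grind

/-- Whoever changes the status of `j` is in charge of `j` from then on, unless `j` is settled; so
threads previously in charge are released without harm. This is why no uniqueness of the thread
that executes `j` is needed. -/
theorem LStep.txnStatus_eq_or (h : LStep B storage t s p s' p') (hp : p.WellFormed) (j : Fin n) :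
    s'.txnStatus j = s.txnStatus j ∨ s'.Settled j ∨ p'.InCharge (s'.txnStatus j).2 j := by
  cases h <;> simp_all [Shared.Settled, PC.WellFormed, PC.InCharge, Function.update_apply]
  all_goals grind

theorem LStep.executed_or_swaps (h : LStep B storage t s p s' p') (b : Fin n)
    (hb : (s'.txnStatus b).2 = .executed) : (s.txnStatus b).2 = .executed ∨ p'.Swaps b := by
  cases h <;> simp_all [PC.Swaps, Function.update_apply]
  all_goals grind

/-- The swap of `txnDependency b` requires its mutex to be free. This excludes that a thread which
has found `b` not executed inserts its transaction only after the swap. -/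
theorem LStep.swaps (h : LStep B storage t s p s' p') (b : Fin n) (hb : p.Swaps b) :
    s.dependencyLock b = none ∧ s'.txnDependency b = ∅ ∧ ¬ p'.Registers b := by
  cases h <;> simp_all [PC.Swaps, PC.Registers]

/-- A thread begins to register with `b` only if `b` is not executed, and only registering threads
become dependents of `b`. -/
theorem LStep.not_executed_of_registers (h : LStep B storage t s p s' p') (b : Fin n)
    (hb : (s'.txnDependency b).Nonempty ∨ p'.Registers b) :
    (s'.txnStatus b).2 ≠ .executed ∨ (s.txnDependency b).Nonempty ∨ p.Registers b := by
  cases h <;> simp_all [PC.Registers, Function.update_apply]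
  all_goals grind [Set.not_nonempty_empty]

theorem LStep.decreaseCnt_le (h : LStep B storage t s p s' p') :
    s.decreaseCnt ≤ s'.decreaseCnt := by
  cases h <;> simp

/-- As long as `decreaseCnt` does not change, every decrease of `executionIdx` leaves behind a
thread that still has to count it. -/
theorem LStep.executionIdx_le (h : LStep B storage t s p s' p')
    (hc : s'.decreaseCnt = s.decreaseCnt) :
    (s.executionIdx ≤ s'.executionIdx ∨ p'.LoweredEx) ∧ (p.LoweredEx → p'.LoweredEx) := by
  cases h <;> simp_all [PC.LoweredEx]

/-- As long as `decreaseCnt` does not change, every decrease of `validationIdx` leaves behind a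
thread that still has to count it. -/
theorem LStep.validationIdx_le (h : LStep B storage t s p s' p')
    (hc : s'.decreaseCnt = s.decreaseCnt) :
    (s.validationIdx ≤ s'.validationIdx ∨ p'.LoweredVal) ∧ (p.LoweredVal → p'.LoweredVal) := by
  cases h <;> simp_all [PC.LoweredVal]

theorem LStep.inert (h : LStep B storage t s p s' p') (hp : p.Inert) (hex : n ≤ s.executionIdx)
    (hval : n ≤ s.validationIdx) (hst : ∀ j, (s.txnStatus j).2 = .executed) :
    p'.Inert ∧ n ≤ s'.executionIdx ∧ n ≤ s'.validationIdx ∧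
      ∀ j, (s'.txnStatus j).2 = .executed := by
  cases h <;> simp_all [PC.Inert, PC.activity]
  all_goals grind

theorem LStep.returned (h : LStep B storage t s p s' p') (task : Option (Task n))
    (hp : p' = .returned task) : s'.doneMarker = true := by
  cases h <;> simp_all

theorem LStep.doneMarker_mono (h : LStep B storage t s p s' p') (hd : s.doneMarker = true) :
    s'.doneMarker = true := by
  cases h <;> simp_all

/-! ### The invariant -/

/-- All transactions are executed, both counters have passed the block, and no thread has or can
obtain a task. -/
structure Config.Quiescent (c : Config n Loc Val σ Thread) : Prop where
  inert : ∀ t, (c.pc t).Inert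
  le_executionIdx : n ≤ c.shared.executionIdx
  le_validationIdx : n ≤ c.shared.validationIdx
  executed : ∀ j, (c.shared.txnStatus j).2 = .executed

/-- `executionIdx` is at least `e`, except for a decrease not yet counted in `decreaseCnt`. -/
def Config.ExAtLeast (c : Config n Loc Val σ Thread) (e : ℕ) : Prop :=
  e ≤ c.shared.executionIdx ∨ ∃ t, (c.pc t).LoweredEx

/-- `validationIdx` is at least `e`, except for a decrease not yet counted in `decreaseCnt`. -/
def Config.ValAtLeast (c : Config n Loc Val σ Thread) (e : ℕ) : Prop :=
  e ≤ c.shared.validationIdx ∨ ∃ t, (c.pc t).LoweredVal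

/-- What a thread inside `check_done` knows about the present configuration, on the condition
that `decreaseCnt` still has the value that it has observed. -/
def Config.CheckDone (c : Config n Loc Val σ Thread) : PC n Loc Val σ → Prop
  | .cdEx k => k ≤ c.shared.decreaseCnt
  | .cdVal k e => k ≤ c.shared.decreaseCnt ∧ (c.shared.decreaseCnt = k → c.ExAtLeast e)
  | .cdActive k => k ≤ c.shared.decreaseCnt ∧
      (c.shared.decreaseCnt = k → c.ExAtLeast n ∧ c.ValAtLeast n)
  | .cdCntAgain k => k ≤ c.shared.decreaseCnt ∧ (c.shared.decreaseCnt = k → c.Quiescent)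
  | .cdSet => c.Quiescent
  | _ => True

/-- The inductive invariant of the algorithm. -/
structure Config.Invariant [Fintype Thread] (c : Config n Loc Val σ Thread) : Prop where
  wellFormed : ∀ t, (c.pc t).WellFormed
  holds : ∀ t b, (c.pc t).Holds b → c.shared.dependencyLock b = some t
  numActiveTasks_eq : c.shared.numActiveTasks = ∑ t, (c.pc t).activity
  lt_of_mem_txnDependency : ∀ b j, j ∈ c.shared.txnDependency b → b < j
  settled_or_inCharge : ∀ j, c.shared.Settled j ∨ ∃ t, (c.pc t).InCharge (c.shared.txnStatus j).2 j
  -- The dependents of `b` are not forgotten: `b` has still to be executed, or to be swapped.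
  not_executed_or_swaps : ∀ b,
    ((c.shared.txnDependency b).Nonempty ∨ ∃ t, (c.pc t).Registers b) →
      (c.shared.txnStatus b).2 ≠ .executed ∨ ∃ t, (c.pc t).Swaps b
  checkDone : ∀ t, c.CheckDone (c.pc t)
  quiescent_of_done : c.shared.doneMarker = true → c.Quiescent

theorem Config.invariant_init [Fintype Thread] :
    (Config.init n Loc Val σ Thread).Invariant := by
  constructor <;> simp [Config.init, Shared.init, PC.WellFormed, PC.Holds, PC.activity,
    Shared.Settled, PC.Registers, Config.CheckDone]

/-- If no task is active and both counters have passed the block, then every transaction is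
executed: nobody is in charge of the least one that is not, so it waits for a smaller one, which
is executed and whose dependencies have therefore been resumed. -/
theorem Config.Invariant.quiescent [Fintype Thread] {c : Config n Loc Val σ Thread}
    (hc : c.Invariant) (h0 : c.shared.numActiveTasks = 0) (hex : c.ExAtLeast n)
    (hval : c.ValAtLeast n) : c.Quiescent := by
  have hact : ∀ t, (c.pc t).activity = 0 := by
    have hsum := hc.numActiveTasks_eq
    rw [h0, eq_comm, Finset.sum_eq_zero_iff_of_nonneg fun t _ => (c.pc t).activity_nonneg] at hsum
    exact fun t => hsum t (Finset.mem_univ t)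
  have hex' : n ≤ c.shared.executionIdx :=
    hex.resolve_right fun ⟨t, ht⟩ => (PC.not_lowered (hact t)).1 ht
  have hval' : n ≤ c.shared.validationIdx :=
    hval.resolve_right fun ⟨t, ht⟩ => (PC.not_lowered (hact t)).2 ht
  refine ⟨fun t => PC.inert_of_activity (hact t), hex', hval', fun j => ?_⟩
  induction j using WellFoundedLT.induction with
  | ind j ih =>
    have hj := (hc.settled_or_inCharge j).resolve_right fun ⟨t, ht⟩ =>
      PC.not_inCharge (hact t) _ _ ht
    rcases hj with hj | ⟨-, hj⟩ | ⟨-, b, hb⟩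
    · exact hj
    · exact absurd (hex'.trans hj) (by simp)
    · rcases hc.not_executed_or_swaps b (.inl ⟨j, hb⟩) with h | ⟨t, ht⟩
      · exact absurd (ih b (hc.lt_of_mem_txnDependency b j hb)) h
      · exact absurd ht (PC.not_swaps (hact t) b)

/-! ### Preservation of the invariant -/

/-- What a thread inside `check_done` knows after one of its own operations, stated in the
configuration before it. The step that finds `numActiveTasks = 0` yields quiescence. -/
theorem LStep.checkDone_self [Fintype Thread] {pc : Thread → PC n Loc Val σ}
    (h : LStep B storage t s p s' p') (hc : (⟨s, pc⟩ : Config n Loc Val σ Thread).Invariant)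
    (hp : (⟨s, pc⟩ : Config n Loc Val σ Thread).CheckDone p) :
    (⟨s, pc⟩ : Config n Loc Val σ Thread).CheckDone p' := by
  have hq := hc.quiescent
  clear hc
  cases h <;> simp only [Config.CheckDone] at hp ⊢
  all_goals grind [Config.ExAtLeast, Config.ValAtLeast]

theorem LStep.doneMarker {pc : Thread → PC n Loc Val σ} (h : LStep B storage t s p s' p')
    (hp : (⟨s, pc⟩ : Config n Loc Val σ Thread).CheckDone p) (hd : s'.doneMarker = true) :
    s.doneMarker = true ∨ (⟨s, pc⟩ : Config n Loc Val σ Thread).Quiescent := by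
  cases h <;> simp_all [Config.CheckDone]

section Step

variable [DecidableEq Thread] {pc : Thread → PC n Loc Val σ}

/-- A property that some thread has is still had by some thread after an operation of `t`, unless
`t` had it. -/
theorem exists_update_or {P : PC n Loc Val σ → Prop} (h : ∃ u, P (pc u)) :
    (∃ u, P (Function.update pc t p' u)) ∨ P (pc t) := by
  obtain ⟨u, hu⟩ := h
  by_cases hut : u = t
  · exact .inr (hut ▸ hu)
  · exact .inl ⟨u, by simpa [hut] using hu⟩

theorem exists_update_self {P : PC n Loc Val σ → Prop} (h : P p') :
    ∃ u, P (Function.update pc t p' u) :=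
  ⟨t, by simpa using h⟩

/-- Quiescence is stable. -/
theorem LStep.quiescent (h : LStep B storage t s (pc t) s' p')
    (hq : (⟨s, pc⟩ : Config n Loc Val σ Thread).Quiescent) :
    (⟨s', Function.update pc t p'⟩ : Config n Loc Val σ Thread).Quiescent := by
  obtain ⟨hp, hex, hval, hst⟩ := h.inert (hq.inert t) hq.le_executionIdx hq.le_validationIdx
    hq.executed
  refine ⟨fun u => ?_, hex, hval, hst⟩
  by_cases hu : u = t
  · simpa [hu] using hp
  · simpa [hu] using hq.inert u

theorem LStep.exAtLeast (h : LStep B storage t s (pc t) s' p')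
    (hc : s'.decreaseCnt = s.decreaseCnt) {e : ℕ}
    (he : (⟨s, pc⟩ : Config n Loc Val σ Thread).ExAtLeast e) :
    (⟨s', Function.update pc t p'⟩ : Config n Loc Val σ Thread).ExAtLeast e := by
  obtain ⟨h1, h2⟩ := h.executionIdx_le hc
  rcases he with he | he
  · exact h1.imp he.trans exists_update_self
  · exact .inr ((exists_update_or he).elim id fun ht => exists_update_self (h2 ht))

theorem LStep.valAtLeast (h : LStep B storage t s (pc t) s' p')
    (hc : s'.decreaseCnt = s.decreaseCnt) {e : ℕ}
    (he : (⟨s, pc⟩ : Config n Loc Val σ Thread).ValAtLeast e) :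
    (⟨s', Function.update pc t p'⟩ : Config n Loc Val σ Thread).ValAtLeast e := by
  obtain ⟨h1, h2⟩ := h.validationIdx_le hc
  rcases he with he | he
  · exact h1.imp he.trans exists_update_self
  · exact .inr ((exists_update_or he).elim id fun ht => exists_update_self (h2 ht))

/-- What a thread inside `check_done` knows stays true when some thread takes a step. -/
theorem LStep.checkDone_update (h : LStep B storage t s (pc t) s' p') (q : PC n Loc Val σ)
    (hq : (⟨s, pc⟩ : Config n Loc Val σ Thread).CheckDone q) :
    (⟨s', Function.update pc t p'⟩ : Config n Loc Val σ Thread).CheckDone q := by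
  have hle := h.decreaseCnt_le
  have hex := @h.exAtLeast
  have hval := @h.valAtLeast
  have hqu := h.quiescent
  cases q <;> simp only [Config.CheckDone] at hq ⊢ <;> grind

theorem LStep.invariant [Fintype Thread] (h : LStep B storage t s (pc t) s' p')
    (hc : (⟨s, pc⟩ : Config n Loc Val σ Thread).Invariant) :
    (⟨s', Function.update pc t p'⟩ : Config n Loc Val σ Thread).Invariant where
  wellFormed u := by
    by_cases hu : u = t
    · simpa [hu] using h.wellFormed (hc.wellFormed t)
    · simpa [hu] using hc.wellFormed u
  holds u b hb := by
    by_cases hu : u = t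
    · subst hu
      exact h.holds (hc.holds u) b (by simpa using hb)
    · exact h.dependencyLock_eq_some (hc.holds t) hu b (hc.holds u b (by simpa [hu] using hb))
  numActiveTasks_eq := by
    have hsum := hc.numActiveTasks_eq
    have hstep := h.numActiveTasks_eq
    simp only [Function.apply_update (fun _ => PC.activity)] at hsum ⊢
    rw [Finset.sum_update_of_mem (Finset.mem_univ t), hstep, hsum,
      ← Finset.add_sum_erase _ _ (Finset.mem_univ t), Finset.sdiff_singleton_eq_erase]
    ring
  lt_of_mem_txnDependency := h.lt_of_mem_txnDependency (hc.wellFormed t) hc.lt_of_mem_txnDependency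
  settled_or_inCharge j := by
    have hupd : p'.InCharge (s'.txnStatus j).2 j →
        ∃ u, (Function.update pc t p' u).InCharge (s'.txnStatus j).2 j :=
      exists_update_self (P := fun q => q.InCharge (s'.txnStatus j).2 j)
    have hself : s.Settled j ∨ (pc t).InCharge (s.txnStatus j).2 j → s'.Settled j ∨
        ∃ u, (Function.update pc t p' u).InCharge (s'.txnStatus j).2 j := fun hj =>
      (h.settled_or_inCharge (hc.wellFormed t) j hj).imp_right hupd
    -- A thread other than `t` stays in charge unless the status of `j` changes under it, and then
    -- `t` takes over.
    rcases hc.settled_or_inCharge j with hj | hj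
    · exact hself (.inl hj)
    · rcases exists_update_or (t := t) (p' := p')
        (P := fun q => q.InCharge (s.txnStatus j).2 j) hj with hj | hj
      · rcases h.txnStatus_eq_or (hc.wellFormed t) j with hst | hst
        · exact .inr (by simpa only [hst] using hj)
        · exact hst.imp_right hupd
      · exact hself (.inr hj)
  not_executed_or_swaps b hb := by
    -- While `t` swaps `txnDependency b`, its mutex is free, so that no thread registers.
    by_cases hswap : (pc t).Swaps b
    · obtain ⟨hlock, hdep, hreg⟩ := h.swaps b hswap
      rcases hb with hb | ⟨u, hu⟩
      · simp [hdep] at hb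
      · by_cases hut : u = t
        · simp [hut, hreg] at hu
        · have := hc.holds u b (PC.Registers.holds (by simpa [hut] using hu))
          simp_all
    · have hb' : ((s'.txnDependency b).Nonempty ∨ p'.Registers b) ∨ ∃ u, (pc u).Registers b := by
        rcases hb with hb | ⟨u, hu⟩
        · exact .inl (.inl hb)
        · by_cases hut : u = t
          · exact .inl (.inr (by simpa [hut] using hu))
          · exact .inr ⟨u, by simpa [hut] using hu⟩
      have hold : (s'.txnStatus b).2 ≠ .executed ∨
          (s.txnDependency b).Nonempty ∨ ∃ u, (pc u).Registers b := by
        rcases hb' with hb' | hb'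
        · exact (h.not_executed_of_registers b hb').imp_right (.imp_right fun ht => ⟨t, ht⟩)
        · exact .inr (.inr hb')
      by_contra! hcon
      rcases h.executed_or_swaps b hcon.1 with hst | hst
      · rcases hc.not_executed_or_swaps b (hold.resolve_left (not_not.2 hcon.1)) with h' | h'
        · exact h' hst
        · obtain ⟨u, hu⟩ := (exists_update_or (t := t) (p' := p')
            (P := fun q => q.Swaps b) h').resolve_right hswap
          exact hcon.2 u hu
      · exact hcon.2 t (by simpa using hst)
  checkDone u := by
    by_cases hu : u = t
    · simpa [hu] using h.checkDone_update p' (h.checkDone_self hc (hc.checkDone t))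
    · simpa [hu] using h.checkDone_update (pc u) (hc.checkDone u)
  quiescent_of_done hd :=
    h.quiescent ((h.doneMarker (hc.checkDone t) hd).elim hc.quiescent_of_done id)

theorem Reachable.invariant [Fintype Thread] {c : Config n Loc Val σ Thread}
    (hc : Reachable B storage c) : c.Invariant := by
  induction hc with
  | refl => exact Config.invariant_init
  | @tail c c' _ hstep ih =>
    obtain ⟨t, p', h, hpc⟩ := hstep
    obtain ⟨s', pc'⟩ := c'
    obtain rfl : pc' = _ := hpc
    exact h.invariant ih

/-- A thread returns only after it has observed `doneMarker`, which is never reset. -/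
theorem Reachable.doneMarker {c : Config n Loc Val σ Thread} (hc : Reachable B storage c)
    {task : Option (Task n)} (ht : c.pc t = .returned task) : c.shared.doneMarker = true := by
  induction hc with
  | refl => simp [Config.init] at ht
  | @tail c c' _ hstep ih =>
    obtain ⟨u, p', h, hpc⟩ := hstep
    rw [hpc] at ht
    by_cases htu : t = u
    · exact h.returned task (by simpa [htu] using ht)
    · exact h.doneMarker_mono (ih (by simpa [htu] using ht))

end Step

/-! ### The global commit index -/

theorem Config.Quiescent.globallyCommitted {c : Config n Loc Val σ Thread} (hc : c.Quiescent)
    (k : Fin n) : c.GloballyCommitted k := by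
  refine k.isLt.trans_le (le_csInf ⟨_, .inl (.inl (.inl rfl))⟩ ?_)
  rintro j (((rfl | ⟨i, -, hi⟩) | ⟨t, ht⟩) | ⟨t, ht⟩)
  · exact hc.le_validationIdx
  · exact absurd (hc.executed i) hi
  · exact (hc.inert t).le (.inl ht)
  · exact (hc.inert t).le (.inr ht)

end BlockSTM

/-- If some thread has returned from `run`, then all transactions of the block are globally
committed. -/
theorem mainTheorem2 {Loc Val σ : Type*} (n numThreads : ℕ) (B : BlockSTM.Block n Loc Val σ)
    (storage : Loc → Val) (c : BlockSTM.Config n Loc Val σ (Fin numThreads))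
    (hc : BlockSTM.Reachable B storage c)
    (hret : ∃ (t : Fin numThreads) (task : Option (BlockSTM.Task n)), c.pc t = .returned task) :
    ∀ k : Fin n, c.GloballyCommitted k := by
  obtain ⟨t, task, ht⟩ := hret
  exact (hc.invariant.quiescent_of_done (hc.doneMarker ht)).globallyCommitted
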